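/- Let $\alpha=(\alpha_1,\dots,\alpha_{\ell(\alpha)})$ be a composition and let $\lambda=(\lambda_1\ge\dots\ge\lambda_{\ell(\lambda)})$ be a partition (either may be empty) such that $\lambda\subseteq\alpha$, that is, $\ell(\lambda)\le\ell(\alpha)$ and $\lambda_i\le\alpha_i$ for $1\le i\le\ell(\lambda)$; put $\lambda_i=0$ for $i>\ell(\lambda)$. The diagram $\alpha/\lambda$ has, in row $i$ counted from the bottom, the cells in columns $\lambda_i+1,\dots,\alpha_i$ $(1\le i\le\ell(\alpha))$, and $|\alpha/\lambda|=|\alpha|-|\lambda|$. Assume that every row of $\alpha/\lambda$ contains at least one cell, and that $\alpha/\lambda$ is connected, meaning that its rows cannot be partitioned into two nonempty sets $R_1$, $R_2$ such that the set of columns spanned by the cells in the rows of $R_1$ and that of $R_2$ are disjoint. Let the strictly advanced extended function of $\alpha/\lambda$ be $$F_{\alpha/\lambda}=\sum_{T}\mathbf{x}^T\in\mathbb{Q}[[x_1,x_2,\dots]],$$ where $T$ runs over all fillings of the cells of $\alpha/\lambda$ with positive integers such that the entries of each column strictly increase from bottom to top and the entries of each row strictly increase from left to right, and $\mathbf{x}^T=\prod_{i\ge1}x_i^{c_i(T)}$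 with $c_i(T)$ the number of times $i$ appears in $T$. If $F_{\alpha/\lambda}$ is symmetric, i.e. lies in the $\mathbb{Q}$-span $\operatorname{Sym}$ of the monomial symmetric functions $m_\nu$ ($\nu$ a partition), then $$F_{\alpha/\lambda}=s_{(1^{|\alpha/\lambda|})},$$ where $s_\nu$ denotes the Schur function, the generating function $\sum_T\mathbf{x}^T$ of the fillings $T$ of the diagram of $\nu$ whose columns strictly increase from bottom to top and whose rows weakly increase from left to right. -/

import Mathlib

namespace SchurLike

/-- The `i`-th part of a composition, with rows indexed from `0` at the bottom, and `0` beyond the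
last part. -/
def part {n : ℕ} (α : Composition n) (i : ℕ) : ℕ := α.blocks.getD i 0

/-- A composition is a partition if its parts weakly decrease. -/
def IsPartition {n : ℕ} (α : Composition n) : Prop := α.blocks.Pairwise (fun x y => y ≤ x)

/-- The containment `β ⊆ α` of compositions: `ℓ(β) ≤ ℓ(α)` and `β_i ≤ α_i` for `i ≤ ℓ(β)`. -/
def Contained {b a : ℕ} (β : Composition b) (α : Composition a) : Prop :=
  β.length ≤ α.length ∧ ∀ i < β.length, part β i ≤ part α i

/-- The empty composition of `0`. -/
def emptyComp : Composition 0 := ⟨[], by simp, by simp⟩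

/-- The cells of the skew diagram `α/β`. The cell `(i, j)` lies in row `i` (from the bottom) and
column `j` (from the left), both indexed from `0`; row `i` of `α/β` consists of the columns
`β_i ≤ j < α_i`. -/
def diagram {a b : ℕ} (α : Composition a) (β : Composition b) : Finset (ℕ × ℕ) :=
  (Finset.range α.length).biUnion
    (fun i => (Finset.Ico (part β i) (part α i)).image (fun j => (i, j)))

theorem mem_diagram {a b : ℕ} (α : Composition a) (β : Composition b) (i j : ℕ) :
    (i, j) ∈ diagram α β ↔ i < α.length ∧ part β i ≤ j ∧ j < part α i := by
  simp [diagram]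

/-- Every row of `α/β` contains at least one cell. -/
def RowsNonempty {a b : ℕ} (α : Composition a) (β : Composition b) : Prop :=
  ∀ i < α.length, ∃ j, (i, j) ∈ diagram α β

/-- The set of columns spanned by the cells of `α/β` that lie in the rows belonging to `R`. -/
def columnsOf {a b : ℕ} (α : Composition a) (β : Composition b) (R : Finset ℕ) : Finset ℕ :=
  ((diagram α β).filter (fun c => c.1 ∈ R)).image Prod.snd

/-- `α/β` is connected: its rows cannot be partitioned into two (nonempty) sets `R₁`, `R₂` spanning
disjoint sets of columns. -/
def DiagramConnected {a b : ℕ} (α : Composition a) (β : Composition b) : Prop :=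
  ¬ ∃ R₁ R₂ : Finset ℕ, R₁.Nonempty ∧ R₂.Nonempty ∧ Disjoint R₁ R₂ ∧
    R₁ ∪ R₂ = Finset.range α.length ∧ Disjoint (columnsOf α β R₁) (columnsOf α β R₂)

/-- A tableau on a finite set `D` of cells: a filling of the cells with positive integers. -/
abbrev Filling (D : Finset (ℕ × ℕ)) : Type := {c : ℕ × ℕ // c ∈ D} → ℕ+

/-- The content of a tableau: the number of times each positive integer appears in it. As an
exponent vector this is the monomial `x^T`. -/
noncomputable def content {D : Finset (ℕ × ℕ)} (T : Filling D) : ℕ+ →₀ ℕ :=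
  ∑ c, Finsupp.single (T c) 1

/-- Column entries strictly increase from bottom to top (whether or not the cells compared are
vertically adjacent). -/
def ColsStrict {D : Finset (ℕ × ℕ)} (T : Filling D) : Prop :=
  ∀ c c' : {c : ℕ × ℕ // c ∈ D}, c.1.2 = c'.1.2 → c.1.1 < c'.1.1 → T c < T c'

/-- Row entries strictly increase from left to right. -/
def RowsStrict {D : Finset (ℕ × ℕ)} (T : Filling D) : Prop :=
  ∀ c c' : {c : ℕ × ℕ // c ∈ D}, c.1.1 = c'.1.1 → c.1.2 < c'.1.2 → T c < T c'

/-- Row entries weakly increase from left to right. -/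
def RowsWeak {D : Finset (ℕ × ℕ)} (T : Filling D) : Prop :=
  ∀ c c' : {c : ℕ × ℕ // c ∈ D}, c.1.1 = c'.1.1 → c.1.2 < c'.1.2 → T c ≤ T c'

/-- Only finitely many tableaux have a given content. -/
theorem finite_content_eq {D : Finset (ℕ × ℕ)} (d : ℕ+ →₀ ℕ) :
    {T : Filling D | content T = d}.Finite := by
  refine (Set.Finite.pi' (t := fun _ : {c : ℕ × ℕ // c ∈ D} => (d.support : Set ℕ+))
    (fun _ => d.support.finite_toSet)).subset ?_
  intro T hT c
  have h : content T = d := hT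
  have h1 : Finsupp.single (T c) 1 ≤ content T :=
    Finset.single_le_sum (f := fun c => Finsupp.single (T c) 1) (fun _ _ => zero_le)
      (Finset.mem_univ c)
  have h2 := h1 (T c)
  rw [h] at h2
  simp only [Finsupp.single_eq_same] at h2
  simp only [Finset.mem_coe, Finsupp.mem_support_iff]
  omega

/-- The generating function `∑_{T ∈ 𝒯} x^T` of a set `𝒯` of tableaux, in `ℚ[[x₁, x₂, …]]`: the
coefficient of a monomial is the (finite) number of `T ∈ 𝒯` with this monomial as `x^T`. -/
noncomputable def genFun {D : Finset (ℕ × ℕ)} (𝒯 : Set (Filling D)) : MvPowerSeries ℕ+ ℚ :=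
  fun d => (({T : Filling D | T ∈ 𝒯 ∧ content T = d}.ncard : ℕ) : ℚ)

/-- The strictly advanced extended function of `α/β`: the generating function of all tableaux of
shape `α/β` with strictly increasing columns and strictly increasing rows. -/
noncomputable def strictlyAdvancedExtended {a b : ℕ} (α : Composition a) (β : Composition b) :
    MvPowerSeries ℕ+ ℚ :=
  genFun {T : Filling (diagram α β) | ColsStrict T ∧ RowsStrict T}

/-- The skew Schur function `s_{ν/μ}` (used for partitions `μ ⊆ ν`): the generating function of the
semistandard Young tableaux of shape `ν/μ`. -/
noncomputable def skewSchur {a b : ℕ} (ν : Composition a) (μ : Composition b) :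
    MvPowerSeries ℕ+ ℚ :=
  genFun {T : Filling (diagram ν μ) | ColsStrict T ∧ RowsWeak T}

/-- The Schur function `s_ν = s_{ν/∅}` (used for partitions `ν`). -/
noncomputable def schur {a : ℕ} (ν : Composition a) : MvPowerSeries ℕ+ ℚ :=
  skewSchur ν emptyComp

open Classical in
/-- The monomial symmetric function `m_ν`: the sum of all distinct monomials
`x_{i_1}^{ν_1} ⋯ x_{i_ℓ}^{ν_ℓ}` with distinct `i_1, …, i_ℓ`. -/
noncomputable def monomialSymm {n : ℕ} (ν : Composition n) : MvPowerSeries ℕ+ ℚ :=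
  fun d => if ∃ i : Fin ν.length ↪ ℕ+, d = ∑ j, Finsupp.single (i j) (ν.blocksFun j)
    then 1 else 0

/-- The space `Sym` of symmetric functions: the linear span in `ℚ[[x₁, x₂, …]]` of the monomial
symmetric functions `m_ν`, over all partitions `ν` of all `n ≥ 0`. -/
noncomputable def SymFun : Submodule ℚ (MvPowerSeries ℕ+ ℚ) :=
  Submodule.span ℚ {f | ∃ (n : ℕ) (ν : Composition n), IsPartition ν ∧ f = monomialSymm ν}

end SchurLike

/-! The fillings are the strictly increasing maps on a finite poset: the cells, ordered by the
transitive closure of the row and column relations. Symmetry makes the number of strict maps of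
given fibre sizes invariant under exchanging adjacent sizes (`swapInvariant_cellOrder`). The core is
`SwapInvariant.comparable_trans`: such a poset is a disjoint union of chains. Connectedness then
leaves a single chain (`comparable_of_connected`), whose generating function is that of one column
(`genFun_eq_schur_ones`).

The core goes by induction on the size. Let `m` be the number of minimal elements. An antichain lies
in a fibre of a strict map; moving the size of that fibre to the value `0`, where only minimal
elements can sit, shows that antichains have at most `m` elements. Without its minimal elements the
poset is still swap invariant, hence a union of chains. By Hall's theorem the bottoms of these
chains are matched to minimal elements below them, so the order `r` contains a union `s` of `m`
chains. Strict maps for `r` and `s` agree when the fibre of `0` has size `m`, hence by invariance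
when any fibre does. If `r` related two different chains, an `s`-strict map with equal values at the
two elements and a fibre of size `m` would give a contradiction. -/

namespace StrictMaps

/-! ### Strict maps and their weights -/

/-- Maps to `ℕ` that strictly increase along the relation `r`. -/
def IsStrict {P : Type} (r : P → P → Prop) (f : P → ℕ) : Prop := ∀ x y, r x y → f x < f y

/-- The sizes of the fibres of a map to `ℕ`. -/
noncomputable def weight {P : Type} (f : P → ℕ) (i : ℕ) : ℕ := {x | f x = i}.ncard

/-- The strict maps of a given weight. -/
def strictMaps {P : Type} (r : P → P → Prop) (d : ℕ → ℕ) : Set (P → ℕ) :=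
  {f | IsStrict r f ∧ weight f = d}

/-- The number of strict maps of a given weight does not change when two adjacent values are
exchanged. -/
def SwapInvariant {P : Type} (r : P → P → Prop) : Prop :=
  ∀ (d : ℕ → ℕ) (i : ℕ),
    (strictMaps r d).ncard ≤ (strictMaps r (d ∘ Equiv.swap i (i + 1))).ncard

/-- Comparability for a strict order. -/
def Comparable {P : Type} (r : P → P → Prop) (x y : P) : Prop := r x y ∨ x = y ∨ r y x

/-- Minimality for a strict order. -/
def IsMinimal {P : Type} (r : P → P → Prop) (x : P) : Prop := ∀ y, ¬ r y x

theorem Comparable.symm {P : Type} {r : P → P → Prop} {x y : P} (h : Comparable r x y) :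
    Comparable r y x := by
  rcases h with h | h | h
  · exact Or.inr (Or.inr h)
  · exact Or.inr (Or.inl h.symm)
  · exact Or.inl h

theorem finite_strictMaps {P : Type} [Finite P] (r : P → P → Prop) (d : ℕ → ℕ) :
    (strictMaps r d).Finite := by
  rcases (strictMaps r d).eq_empty_or_nonempty with h | ⟨f₀, -, h₀⟩
  · rw [h]; exact Set.finite_empty
  refine (Set.Finite.pi' (t := fun _ : P => Set.range f₀) (fun _ => Set.finite_range f₀)).subset ?_
  rintro f ⟨-, hf⟩ x
  have h1 : weight f (f x) ≠ 0 := by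
    exact ((Set.ncard_pos (Set.toFinite {y | f y = f x})).2 ⟨x, rfl⟩).ne'
  rw [hf, ← h₀] at h1
  obtain ⟨y, hy⟩ := Set.nonempty_of_ncard_ne_zero h1
  exact ⟨y, hy⟩

/-- The exchange is an involution, so the inequality applied twice gives equality. -/
theorem SwapInvariant.ncard_eq {P : Type} {r : P → P → Prop} (h : SwapInvariant r)
    (d : ℕ → ℕ) (i : ℕ) :
    (strictMaps r d).ncard = (strictMaps r (d ∘ Equiv.swap i (i + 1))).ncard := by
  refine le_antisymm (h d i) ?_
  have h1 := h (d ∘ Equiv.swap i (i + 1)) i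
  have h2 : (d ∘ Equiv.swap i (i + 1)) ∘ Equiv.swap i (i + 1) = d := by
    funext j; simp
  rwa [h2] at h1

/-- Any part of the weight can be moved to the value `0`. -/
theorem exists_weight_zero_eq {P : Type} {r s : P → P → Prop} (hr : SwapInvariant r)
    (hs : SwapInvariant s) (k : ℕ) : ∀ d : ℕ → ℕ, ∃ d' : ℕ → ℕ, d' 0 = d k ∧
      (strictMaps r d).ncard = (strictMaps r d').ncard ∧
      (strictMaps s d).ncard = (strictMaps s d').ncard := by
  -- Adjacent exchanges carry the entry at `k` down to `0`. They depend on `d` and `k` only, so the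
  -- same `d'` serves both relations.
  induction k with
  | zero => exact fun d => ⟨d, rfl, rfl, rfl⟩
  | succ k ih =>
    intro d
    obtain ⟨d', h0, h1, h2⟩ := ih (d ∘ Equiv.swap k (k + 1))
    refine ⟨d', ?_, ?_, ?_⟩
    · rw [h0]; simp
    · rw [← h1]; exact hr.ncard_eq d k
    · rw [← h2]; exact hs.ncard_eq d k

/-! ### Antichains and minimal elements -/

/-- The number of elements below a given one. -/
noncomputable def height {P : Type} (r : P → P → Prop) (x : P) : ℕ := {y | r y x}.ncard

theorem height_lt_height {P : Type} [Finite P] {r : P → P → Prop} (hirr : ∀ x, ¬ r x x)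
    (htr : ∀ x y z, r x y → r y z → r x z) {x y : P} (h : r x y) : height r x < height r y := by
  refine Set.ncard_lt_ncard ?_ (Set.toFinite _)
  refine ⟨fun z hz => htr _ _ _ hz h, fun hle => hirr x (hle h)⟩

theorem height_lt_card {P : Type} [Finite P] {r : P → P → Prop} (hirr : ∀ x, ¬ r x x) (x : P) :
    height r x < Nat.card P := by
  rw [← Set.ncard_univ]
  refine Set.ncard_lt_ncard ?_ (Set.toFinite _)
  exact ⟨fun z _ => trivial, fun hle => hirr x (hle (Set.mem_univ x))⟩

theorem exists_strict_eq_on_antichain {P : Type} [Finite P] {r : P → P → Prop}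
    (hirr : ∀ x, ¬ r x x) (htr : ∀ x y z, r x y → r y z → r x z) (A : Set P)
    (hA : ∀ x ∈ A, ∀ y ∈ A, ¬ r x y) : ∃ f k, IsStrict r f ∧ ∀ x ∈ A, f x = k := by
  classical
  -- Heights are less than `Nat.card P`, so this puts the elements below `A` under the level of `A`,
  -- and all remaining elements above it.
  refine ⟨fun z => if z ∈ A then Nat.card P else if ∃ a ∈ A, r z a then height r z
    else Nat.card P + 1 + height r z, Nat.card P, ?_, fun x hx => by simp [hx]⟩
  intro x y hxy
  have h1 := height_lt_height hirr htr hxy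
  have h2 := height_lt_card hirr x
  have h3 := height_lt_card hirr y
  by_cases hyA : y ∈ A
  · have hxA : x ∉ A := fun hx => hA x hx y hyA hxy
    have : ∃ a ∈ A, r x a := ⟨y, hyA, hxy⟩
    simp only [hyA, hxA, this, if_true, if_false]
    exact h2
  · by_cases hyD : ∃ a ∈ A, r y a
    · obtain ⟨a, ha, hya⟩ := hyD
      have hxA : x ∉ A := fun hx => hA x hx a ha (htr _ _ _ hxy hya)
      have h4 : ∃ a ∈ A, r x a := ⟨a, ha, htr _ _ _ hxy hya⟩
      have h5 : ∃ a ∈ A, r y a := ⟨a, ha, hya⟩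
      simp only [hyA, hxA, h4, h5, if_true, if_false]
      exact h1
    · simp only [hyA, hyD, if_false]
      split_ifs <;> omega

/-- The antichains are at most as large as the set of minimal elements. -/
theorem SwapInvariant.ncard_antichain_le {P : Type} [Finite P] {r : P → P → Prop}
    (h : SwapInvariant r) (hirr : ∀ x, ¬ r x x) (htr : ∀ x y z, r x y → r y z → r x z) (A : Set P)
    (hA : ∀ x ∈ A, ∀ y ∈ A, ¬ r x y) : A.ncard ≤ {x | IsMinimal r x}.ncard := by
  obtain ⟨f, k, hf, hk⟩ := exists_strict_eq_on_antichain hirr htr A hA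
  obtain ⟨d', h0, h1, -⟩ := exists_weight_zero_eq h h k (weight f)
  have hne : (strictMaps r (weight f)).ncard ≠ 0 :=
    ((Set.ncard_pos (finite_strictMaps r _)).2 ⟨f, hf, rfl⟩).ne'
  rw [h1] at hne
  obtain ⟨g, hg, hgw⟩ := Set.nonempty_of_ncard_ne_zero hne
  have h2 : A.ncard ≤ weight f k := Set.ncard_le_ncard (fun x hx => hk x hx) (Set.toFinite _)
  have h3 : weight g 0 ≤ {x | IsMinimal r x}.ncard := by
    refine Set.ncard_le_ncard (fun x hx y hy => ?_) (Set.toFinite _)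
    have := hg _ _ hy
    have hx' : g x = 0 := hx
    omega
  rw [hgw, h0] at h3
  exact h2.trans h3

/-! ### Removing the minimal elements -/

/-- The restriction to the elements that are not minimal. -/
def aboveMinimal {P : Type} (r : P → P → Prop) (x y : {x : P // ¬ IsMinimal r x}) : Prop := r x.1 y.1

open Classical in
/-- Extension of a map by `0` to the minimal elements. -/
noncomputable def extendZero {P : Type} (r : P → P → Prop) (g : {x : P // ¬ IsMinimal r x} → ℕ)
    (x : P) : ℕ := if h : IsMinimal r x then 0 else g ⟨x, h⟩ + 1

/-- The weight `m, d 0, d 1, …`. -/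
def consWeight (m : ℕ) (d : ℕ → ℕ) : ℕ → ℕ
  | 0 => m
  | i + 1 => d i

theorem extendZero_of_not {P : Type} {r : P → P → Prop} (g : {x : P // ¬ IsMinimal r x} → ℕ)
    {x : P} (h : ¬ IsMinimal r x) : extendZero r g x = g ⟨x, h⟩ + 1 := by
  simp [extendZero, h]

theorem extendZero_eq_zero {P : Type} {r : P → P → Prop} (g : {x : P // ¬ IsMinimal r x} → ℕ)
    {x : P} : extendZero r g x = 0 ↔ IsMinimal r x := by
  unfold extendZero
  split_ifs with h <;> simp [h]

theorem weight_extendZero {P : Type} (r : P → P → Prop) (g : {x : P // ¬ IsMinimal r x} → ℕ) :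
    weight (extendZero r g) = consWeight {x | IsMinimal r x}.ncard (weight g) := by
  funext i
  cases i with
  | zero => simp [weight, consWeight, extendZero_eq_zero]
  | succ i =>
    have : {x | extendZero r g x = i + 1} = Subtype.val '' {x | g x = i} := by
      ext x
      constructor
      · intro hx
        have hx' : extendZero r g x = i + 1 := hx
        have hm : ¬ IsMinimal r x := fun hm => by
          rw [(extendZero_eq_zero g).2 hm] at hx'; omega
        rw [extendZero_of_not g hm] at hx'
        exact ⟨⟨x, hm⟩, by simpa using hx', rfl⟩
      · rintro ⟨⟨y, hy⟩, hy', rfl⟩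
        have hy'' : g ⟨y, hy⟩ = i := hy'
        simp [extendZero_of_not g hy, hy'']
    simp only [weight, consWeight]
    rw [this, Set.ncard_image_of_injective _ Subtype.val_injective]

/-- Nothing lies strictly below the value `0`, so the fibre of `0` consists of minimal elements; its
size forces it to contain them all. -/
theorem zero_fiber_eq {P : Type} [Finite P] {r : P → P → Prop} {f : P → ℕ} (hf : IsStrict r f)
    (h0 : weight f 0 = {x | IsMinimal r x}.ncard) (x : P) : f x = 0 ↔ IsMinimal r x := by
  have h1 : {x | f x = 0} = {x | IsMinimal r x} := by
    refine Set.eq_of_subset_of_ncard_le ?_ h0.ge (Set.toFinite _)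
    intro x hx y hy
    have := hf _ _ hy
    have hx' : f x = 0 := hx
    omega
  exact Set.ext_iff.1 h1 x

/-- Extension by `0` is a bijection: the prescribed size of the fibre of `0` makes it exactly the
set of minimal elements, and the rest is shifted down by one. -/
theorem ncard_strictMaps_aboveMinimal {P : Type} [Finite P] (r : P → P → Prop) (d : ℕ → ℕ) :
    (strictMaps (aboveMinimal r) d).ncard =
      (strictMaps r (consWeight {x | IsMinimal r x}.ncard d)).ncard := by
  have himg : extendZero r '' strictMaps (aboveMinimal r) d =
      strictMaps r (consWeight {x | IsMinimal r x}.ncard d) := by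
    ext f
    constructor
    · rintro ⟨g, ⟨hg, rfl⟩, rfl⟩
      refine ⟨fun x y hxy => ?_, weight_extendZero r g⟩
      have hy : ¬ IsMinimal r y := fun hy => hy x hxy
      by_cases hx : IsMinimal r x
      · rw [(extendZero_eq_zero g).2 hx, extendZero_of_not g hy]; omega
      · rw [extendZero_of_not g hx, extendZero_of_not g hy]
        have := hg ⟨x, hx⟩ ⟨y, hy⟩ hxy
        omega
    · rintro ⟨hf, hw⟩
      have hz := zero_fiber_eq hf (by rw [hw]; rfl)
      have hext : extendZero r (fun x => f x.1 - 1) = f := by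
        funext x
        by_cases hx : IsMinimal r x
        · rw [(extendZero_eq_zero _).2 hx, (hz x).2 hx]
        · rw [extendZero_of_not _ hx]
          have : f x ≠ 0 := fun h => hx ((hz x).1 h)
          simp only
          omega
      refine ⟨fun x => f x.1 - 1, ⟨fun x y hxy => ?_, ?_⟩, hext⟩
      · have h1 := hf x.1 y.1 hxy
        have h2 : f x.1 ≠ 0 := fun h => x.2 ((hz x.1).1 h)
        simp only
        omega
      · have h1 := weight_extendZero r (fun x => f x.1 - 1)
        rw [hext, hw] at h1
        funext i
        exact (congrFun h1 (i + 1)).symm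
  rw [← himg, Set.ncard_image_of_injective]
  intro g g' hgg
  funext x
  have := congrFun hgg x.1
  rw [extendZero_of_not g x.2, extendZero_of_not g' x.2] at this
  exact Nat.succ_injective this

theorem SwapInvariant.restrict {P : Type} [Finite P] {r : P → P → Prop} (h : SwapInvariant r) :
    SwapInvariant (aboveMinimal r) := by
  intro d i
  rw [ncard_strictMaps_aboveMinimal, ncard_strictMaps_aboveMinimal]
  -- Exchanging positions `i + 1` and `i + 2` leaves the leading entry untouched.
  have h1 := h (consWeight {x | IsMinimal r x}.ncard d) (i + 1)
  have h2 : consWeight {x | IsMinimal r x}.ncard d ∘ Equiv.swap (i + 1) (i + 1 + 1) =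
      consWeight {x | IsMinimal r x}.ncard (d ∘ Equiv.swap i (i + 1)) := by
    funext j
    cases j with
    | zero => simp [consWeight, Equiv.swap_apply_def]
    | succ j =>
      simp only [Function.comp, Equiv.swap_apply_def, consWeight]
      split_ifs <;> first | rfl | omega
  rwa [h2] at h1

/-! ### Disjoint unions of chains are swap invariant -/

open Classical in
/-- Exchange the values `i` and `i + 1` on every class of `κ` that does not take both. -/
noncomputable def classSwap {P ι : Type} (κ : P → ι) (i : ℕ) (f : P → ℕ) (x : P) : ℕ :=
  if (∃ y, κ y = κ x ∧ f y = i) ∧ (∃ y, κ y = κ x ∧ f y = i + 1) then f x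
  else Equiv.swap i (i + 1) (f x)

theorem classSwap_of_both {P ι : Type} {κ : P → ι} {i : ℕ} {f : P → ℕ} {x : P}
    (h : (∃ y, κ y = κ x ∧ f y = i) ∧ (∃ y, κ y = κ x ∧ f y = i + 1)) {y : P} (hy : κ y = κ x) :
    classSwap κ i f y = f y := by
  unfold classSwap
  rw [if_pos (by rwa [hy])]

theorem classSwap_of_not_both {P ι : Type} {κ : P → ι} {i : ℕ} {f : P → ℕ} {x : P}
    (h : ¬ ((∃ y, κ y = κ x ∧ f y = i) ∧ (∃ y, κ y = κ x ∧ f y = i + 1))) {y : P}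
    (hy : κ y = κ x) : classSwap κ i f y = Equiv.swap i (i + 1) (f y) := by
  unfold classSwap
  rw [if_neg (by rwa [hy])]

theorem classSwap_classSwap {P ι : Type} (κ : P → ι) (i : ℕ) (f : P → ℕ) :
    classSwap κ i (classSwap κ i f) = f := by
  funext x
  by_cases h : (∃ y, κ y = κ x ∧ f y = i) ∧ (∃ y, κ y = κ x ∧ f y = i + 1)
  · have h' : (∃ y, κ y = κ x ∧ classSwap κ i f y = i) ∧
        (∃ y, κ y = κ x ∧ classSwap κ i f y = i + 1) := by
      obtain ⟨⟨y, hy, hy'⟩, z, hz, hz'⟩ := h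
      have h : (∃ y, κ y = κ x ∧ f y = i) ∧ (∃ y, κ y = κ x ∧ f y = i + 1) :=
        ⟨⟨y, hy, hy'⟩, z, hz, hz'⟩
      exact ⟨⟨y, hy, by rw [classSwap_of_both h hy, hy']⟩,
        z, hz, by rw [classSwap_of_both h hz, hz']⟩
    rw [classSwap_of_both h' rfl, classSwap_of_both h rfl]
  · have h' : ¬ ((∃ y, κ y = κ x ∧ classSwap κ i f y = i) ∧
        (∃ y, κ y = κ x ∧ classSwap κ i f y = i + 1)) := by
      rintro ⟨⟨y, hy, hy'⟩, z, hz, hz'⟩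
      rw [classSwap_of_not_both h hy, Equiv.swap_apply_eq_iff, Equiv.swap_apply_left] at hy'
      rw [classSwap_of_not_both h hz, Equiv.swap_apply_eq_iff, Equiv.swap_apply_right] at hz'
      exact h ⟨⟨z, hz, hz'⟩, y, hy, hy'⟩
    rw [classSwap_of_not_both h' rfl, classSwap_of_not_both h rfl, Equiv.swap_apply_self]

theorem swap_lt_swap {i a b : ℕ} (hab : a < b) (h : ¬ (a = i ∧ b = i + 1)) :
    Equiv.swap i (i + 1) a < Equiv.swap i (i + 1) b := by
  simp only [Equiv.swap_apply_def]
  split_ifs <;> omega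

theorem IsStrict.injOn_class {P ι : Type} {κ : P → ι} {s : P → P → Prop}
    (hchain : ∀ x y, κ x = κ y → Comparable s x y) {f : P → ℕ} (hf : IsStrict s f) (j : ℕ) :
    Set.InjOn κ {x | f x = j} := by
  intro x hx y hy hxy
  have hx' : f x = j := hx
  have hy' : f y = j := hy
  rcases hchain x y hxy with h | h | h
  · have := hf _ _ h; omega
  · exact h
  · have := hf _ _ h; omega

/-- A disjoint union of chains is swap invariant. -/
theorem swapInvariant_of_chains {P ι : Type} [Finite P] {κ : P → ι} {s : P → P → Prop}
    (hκ : ∀ x y, s x y → κ x = κ y) (hchain : ∀ x y, κ x = κ y → Comparable s x y) :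
    SwapInvariant s := by
  intro d i
  refine Set.ncard_le_ncard_of_injOn (classSwap κ i) ?_ ?_ (finite_strictMaps s _)
  · rintro f ⟨hf, rfl⟩
    have hstrict : IsStrict s (classSwap κ i f) := by
      intro x y hxy
      have hlt := hf _ _ hxy
      by_cases h : (∃ z, κ z = κ x ∧ f z = i) ∧ (∃ z, κ z = κ x ∧ f z = i + 1)
      · rwa [classSwap_of_both h rfl, classSwap_of_both h (hκ _ _ hxy).symm]
      · rw [classSwap_of_not_both h rfl, classSwap_of_not_both h (hκ _ _ hxy).symm]
        refine swap_lt_swap hlt ?_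
        rintro ⟨h1, h2⟩
        exact h ⟨⟨x, rfl, h1⟩, y, (hκ _ _ hxy).symm, h2⟩
    refine ⟨hstrict, ?_⟩
    funext j
    simp only [Function.comp, weight]
    -- A fibre meets each chain at most once, so a weight counts the chains that take the value. It
    -- remains to see that the chains taking `i` and those taking `i + 1` are exchanged.
    rw [← (hstrict.injOn_class hchain j).ncard_image, ← (hf.injOn_class hchain _).ncard_image]
    congr 1
    ext c
    constructor
    · rintro ⟨x, hx, rfl⟩
      have hx' : classSwap κ i f x = j := hx
      by_cases h : (∃ z, κ z = κ x ∧ f z = i) ∧ (∃ z, κ z = κ x ∧ f z = i + 1)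
      · rw [classSwap_of_both h rfl] at hx'
        obtain ⟨⟨y, hy, hy'⟩, z, hz, hz'⟩ := h
        by_cases h1 : j = i
        · exact ⟨z, by simp [h1, hz'], hz⟩
        by_cases h2 : j = i + 1
        · exact ⟨y, by simp [h2, hy'], hy⟩
        exact ⟨x, by simp [Equiv.swap_apply_of_ne_of_ne h1 h2, hx'], rfl⟩
      · rw [classSwap_of_not_both h rfl] at hx'
        exact ⟨x, by simp [← hx'], rfl⟩
    · rintro ⟨x, hx, rfl⟩
      have hx' : f x = Equiv.swap i (i + 1) j := hx
      by_cases h : (∃ z, κ z = κ x ∧ f z = i) ∧ (∃ z, κ z = κ x ∧ f z = i + 1)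
      · have h' := h
        obtain ⟨⟨y, hy, hy'⟩, z, hz, hz'⟩ := h'
        by_cases h1 : j = i
        · exact ⟨y, by simp [h1, classSwap_of_both h hy, hy'], hy⟩
        by_cases h2 : j = i + 1
        · exact ⟨z, by simp [h2, classSwap_of_both h hz, hz'], hz⟩
        rw [Equiv.swap_apply_of_ne_of_ne h1 h2] at hx'
        exact ⟨x, by simp [classSwap_of_both h rfl, hx'], rfl⟩
      · exact ⟨x, by simp [classSwap_of_not_both h rfl, hx'], rfl⟩
  · intro f _ g _ hfg
    rw [← classSwap_classSwap κ i f, ← classSwap_classSwap κ i g]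
    rw [hfg]

/-! ### Chains through the minimal elements -/

theorem exists_isMinimal_below {P : Type} [Finite P] {r : P → P → Prop} (hirr : ∀ x, ¬ r x x)
    (htr : ∀ x y z, r x y → r y z → r x z) (x : P) : ∃ b, IsMinimal r b ∧ (b = x ∨ r b x) := by
  obtain ⟨b, hb, hmin⟩ := Set.exists_min_image {b | b = x ∨ r b x} (height r) (Set.toFinite _)
    ⟨x, Or.inl rfl⟩
  refine ⟨b, fun y hy => ?_, hb⟩
  have hyx : r y x := by
    rcases hb with rfl | hb
    · exact hy
    · exact htr _ _ _ hy hb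
  have h1 := hmin y (Or.inr hyx)
  have h2 := height_lt_height hirr htr hy
  omega

/-- The minimal ones among the elements that are not minimal can be matched to minimal elements
below them. -/
theorem exists_matching {P : Type} [Finite P] {r : P → P → Prop}
    (h : SwapInvariant r) (hirr : ∀ x, ¬ r x x) (htr : ∀ x y z, r x y → r y z → r x z) :
    ∃ φ : {b // IsMinimal (aboveMinimal r) b} → P, Function.Injective φ ∧
      ∀ b, IsMinimal r (φ b) ∧ r (φ b) b.1.1 := by
  classical
  have := Fintype.ofFinite P
  have hHall := (Finset.all_card_le_biUnion_card_iff_exists_injective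
    (fun b : {b // IsMinimal (aboveMinimal r) b} =>
      Finset.univ.filter (fun x => IsMinimal r x ∧ r x b.1.1))).1 ?_
  · obtain ⟨φ, hφ, hφ'⟩ := hHall
    exact ⟨φ, hφ, fun b => by simpa using hφ' b⟩
  intro S
  set N := S.biUnion (fun b : {b // IsMinimal (aboveMinimal r) b} =>
    Finset.univ.filter (fun x => IsMinimal r x ∧ r x b.1.1)) with hN
  set M : Finset P := Finset.univ.filter (fun x => IsMinimal r x) with hM
  set B : Finset P := S.image (fun b => b.1.1) with hB
  have hNM : N ⊆ M := by
    intro x hx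
    simp only [hN, Finset.mem_biUnion, Finset.mem_filter] at hx
    obtain ⟨b, -, -, hx, -⟩ := hx
    simp [hM, hx]
  have hcB : B.card = S.card :=
    Finset.card_image_of_injective _
      (fun b c hbc => Subtype.ext (Subtype.ext hbc))
  have hdisj : Disjoint B (M \ N) := by
    rw [Finset.disjoint_left]
    intro x hx hx'
    simp only [hB, Finset.mem_image] at hx
    obtain ⟨b, -, rfl⟩ := hx
    simp only [hM, Finset.mem_sdiff, Finset.mem_filter] at hx'
    exact b.1.2 hx'.1.2
  -- `B` together with the minimal elements below no member of `B` is an antichain. The bound `|B| +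
  -- |M| - |N| ≤ |M|` is Hall's condition `|S| ≤ |N|`.
  have hanti := h.ncard_antichain_le hirr htr (↑(B ∪ (M \ N))) (by
    intro x hx y hy hxy
    simp only [Finset.coe_union, Set.mem_union, Finset.mem_coe] at hx hy
    rcases hy with hy | hy
    · simp only [hB, Finset.mem_image] at hy
      obtain ⟨b, hbS, rfl⟩ := hy
      rcases hx with hx | hx
      · simp only [hB, Finset.mem_image] at hx
        obtain ⟨c, -, rfl⟩ := hx
        exact b.2 c.1 hxy
      · rw [Finset.mem_sdiff] at hx
        refine hx.2 ?_
        simp only [hN, Finset.mem_biUnion, Finset.mem_filter]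
        exact ⟨b, hbS, Finset.mem_univ _, by simpa [hM] using hx.1, hxy⟩
    · simp only [hM, Finset.mem_sdiff, Finset.mem_filter] at hy
      exact hy.1.2 x hxy)
  have hMc : {x | IsMinimal r x}.ncard = M.card := by
    rw [← Set.ncard_coe_finset]
    congr 1
    ext x
    simp [hM]
  rw [Set.ncard_coe_finset, Finset.card_union_of_disjoint hdisj, hMc, hcB,
    Finset.card_sdiff_of_subset hNM] at hanti
  have := Finset.card_le_card hNM
  omega

/-- If the elements that are not minimal form a disjoint union of chains, a swap invariant order
contains a disjoint union of chains, indexed by the minimal elements, that only misses relations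
involving minimal elements. -/
theorem exists_chain_classes {P : Type} [Finite P] {r : P → P → Prop}
    (h : SwapInvariant r) (hirr : ∀ x, ¬ r x x) (htr : ∀ x y z, r x y → r y z → r x z)
    (hup : ∀ x y z, Comparable (aboveMinimal r) x y → Comparable (aboveMinimal r) y z →
      Comparable (aboveMinimal r) x z) :
    ∃ κ : P → P, (∀ x, IsMinimal r (κ x)) ∧ (∀ x, IsMinimal r x → κ x = x) ∧
      (∀ x, ¬ IsMinimal r x → r (κ x) x) ∧ (∀ x y, κ x = κ y → Comparable r x y) ∧
      (∀ x y, ¬ IsMinimal r x → r x y → κ x = κ y) := by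
  classical
  obtain ⟨φ, hφ, hφ'⟩ := exists_matching h hirr htr
  have hbot := fun x => exists_isMinimal_below (r := aboveMinimal r) (fun x => hirr x.1)
    (fun x y z => htr x.1 y.1 z.1) x
  choose bot hbmin hble using hbot
  have hbc : ∀ x, Comparable (aboveMinimal r) (bot x) x := fun x => by
    rcases hble x with h | h
    · exact Or.inr (Or.inl h)
    · exact Or.inl h
  -- Bottoms of comparable elements are comparable by transitivity, and comparable minimal elements
  -- coincide.
  have hbeq : ∀ x y, Comparable (aboveMinimal r) x y → bot x = bot y := by
    intro x y hxy
    rcases hup _ _ _ (hup _ _ _ (hbc x) hxy) (hbc y).symm with h | h | h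
    · exact absurd h (hbmin y _)
    · exact h
    · exact absurd h (hbmin x _)
  -- A chain is labelled by the minimal element matched to its bottom; minimal elements label
  -- themselves.
  let κ : P → P := fun x => if hx : IsMinimal r x then x else φ ⟨bot ⟨x, hx⟩, hbmin _⟩
  have hκ1 : ∀ x, IsMinimal r x → κ x = x := fun x hx => by simp [κ, hx]
  have hκ2 : ∀ x (hx : ¬ IsMinimal r x), κ x = φ ⟨bot ⟨x, hx⟩, hbmin _⟩ := fun x hx => by
    simp [κ, hx]
  have hκ3 : ∀ x, ¬ IsMinimal r x → r (κ x) x := fun x hx => by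
    rw [hκ2 x hx]
    have h1 := (hφ' ⟨bot ⟨x, hx⟩, hbmin _⟩).2
    rcases hble ⟨x, hx⟩ with h | h
    · have h2 : (bot ⟨x, hx⟩).1 = x := congrArg Subtype.val h
      rwa [h2] at h1
    · exact htr _ _ _ h1 h
  refine ⟨κ, fun x => ?_, hκ1, hκ3, fun x y hxy => ?_, fun x y hx hxy => ?_⟩
  · by_cases hx : IsMinimal r x
    · rwa [hκ1 x hx]
    · rw [hκ2 x hx]; exact (hφ' _).1
  · by_cases hx : IsMinimal r x <;> by_cases hy : IsMinimal r y
    · rw [hκ1 x hx, hκ1 y hy] at hxy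
      exact Or.inr (Or.inl hxy)
    · rw [hκ1 x hx] at hxy
      exact Or.inl (hxy ▸ hκ3 y hy)
    · rw [hκ1 y hy] at hxy
      exact Or.inr (Or.inr (hxy ▸ hκ3 x hx))
    · rw [hκ2 x hx, hκ2 y hy] at hxy
      have h1 := congrArg Subtype.val (hφ hxy)
      simp only at h1
      have h2 := hbc ⟨x, hx⟩
      rw [h1] at h2
      rcases hup _ _ _ h2.symm (hbc ⟨y, hy⟩) with h | h | h
      · exact Or.inl h
      · exact Or.inr (Or.inl (congrArg Subtype.val h))
      · exact Or.inr (Or.inr h)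
  · have hy : ¬ IsMinimal r y := fun hy => hy x hxy
    rw [hκ2 x hx, hκ2 y hy]
    congr 2
    exact hbeq _ _ (Or.inl hxy)

/-! ### Swap invariant orders are disjoint unions of chains -/

/-- In a disjoint union of chains, two elements of different chains take the same value under a
strict map with a fibre that meets every chain. -/
theorem exists_strict_eq_of_class_ne {P : Type} [Finite P] {s : P → P → Prop} {M : Set P}
    {κ : P → P} (hirr : ∀ x, ¬ s x x) (htr : ∀ x y z, s x y → s y z → s x z)
    (hκ : ∀ x y, s x y → κ x = κ y) (hchain : ∀ x y, κ x = κ y → Comparable s x y)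
    (hM : ∀ x, κ x ∈ M) (hMκ : ∀ x ∈ M, κ x = x) {x y : P} (hxy : κ x ≠ κ y) :
    ∃ f k, IsStrict s f ∧ f x = f y ∧ weight f k = M.ncard := by
  classical
  -- One element of each chain: `x` and `y` on their own chains, the label itself elsewhere.
  let sec : P → P := fun c => if c = κ x then x else if c = κ y then y else c
  have hsec : ∀ c ∈ M, κ (sec c) = c := by
    intro c hc
    simp only [sec]
    split_ifs with h1 h2
    · exact h1.symm
    · exact h2.symm
    · exact hMκ c hc
  have hsx : sec (κ x) = x := by simp [sec]
  have hsy : sec (κ y) = y := by simp [sec, hxy.symm]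
  have hlt := height_lt_card hirr
  -- Each chain is graded by height and shifted so that its chosen element has the value `Nat.card
  -- P`. This exceeds all heights, so the subtraction never truncates.
  refine ⟨fun z => Nat.card P + height s z - height s (sec (κ z)), Nat.card P, ?_, ?_, ?_⟩
  · intro z w hzw
    have h1 := height_lt_height hirr htr hzw
    have h2 := hlt (sec (κ w))
    simp only [hκ z w hzw]
    omega
  · simp only [hsx, hsy]
    omega
  · have : {z | Nat.card P + height s z - height s (sec (κ z)) = Nat.card P} = sec '' M := by
      ext z
      constructor
      · intro hz
        have hz' : Nat.card P + height s z - height s (sec (κ z)) = Nat.card P := hz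
        refine ⟨κ z, hM z, ?_⟩
        have h2 := hlt (sec (κ z))
        rcases hchain _ _ (hsec _ (hM z)) with h | h | h
        · have := height_lt_height hirr htr h; omega
        · exact h
        · have := height_lt_height hirr htr h; omega
      · rintro ⟨c, hc, rfl⟩
        have h2 := hlt (sec c)
        simp only [Set.mem_ofPred_eq, hsec c hc]
        omega
    unfold weight
    rw [this]
    refine Set.InjOn.ncard_image (fun a ha b hb hab => ?_)
    rw [← hsec a ha, ← hsec b hb, hab]

/-- In a swap invariant finite strict order comparability is transitive: the order is a disjoint
union of chains. -/
theorem SwapInvariant.comparable_trans (n : ℕ) : ∀ {P : Type} [Finite P] {r : P → P → Prop},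
    Nat.card P = n → SwapInvariant r → (∀ x, ¬ r x x) → (∀ x y z, r x y → r y z → r x z) →
    ∀ x y z, Comparable r x y → Comparable r y z → Comparable r x z := by
  induction n using Nat.strong_induction_on with
  | _ n ih =>
  intro P _ r hn h hirr htr x₀ y₀ z₀ hxy₀ hyz₀
  have hlt : Nat.card {x : P // ¬ IsMinimal r x} < n := by
    rw [← hn]
    obtain ⟨b, hb, -⟩ := exists_isMinimal_below hirr htr x₀
    exact Finite.card_subtype_lt (x := b) (not_not.2 hb)
  have hup := ih _ hlt (r := aboveMinimal r) rfl h.restrict (fun x => hirr x.1)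
    (fun x y z => htr x.1 y.1 z.1)
  obtain ⟨κ, hκM, hκ1, hκ2, hκ3, hκ4⟩ := exists_chain_classes h hirr htr hup
  let s : P → P → Prop := fun x y => r x y ∧ κ x = κ y
  have hschain : ∀ x y, κ x = κ y → Comparable s x y := by
    intro x y hxy
    rcases hκ3 x y hxy with h | h | h
    · exact Or.inl ⟨h, hxy⟩
    · exact Or.inr (Or.inl h)
    · exact Or.inr (Or.inr ⟨h, hxy.symm⟩)
  have hs : SwapInvariant s := swapInvariant_of_chains (κ := κ) (fun x y h => h.2) hschain
  have hsub : ∀ d, strictMaps r d ⊆ strictMaps s d :=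
    fun d f hf => ⟨fun x y hxy => hf.1 x y hxy.1, hf.2⟩
  have hminiff : ∀ x, IsMinimal s x ↔ IsMinimal r x := by
    refine fun x => ⟨fun hx => ?_, fun hx y hy => hx y hy.1⟩
    by_contra hx'
    exact hx (κ x) ⟨hκ2 x hx', hκ1 _ (hκM x)⟩
  -- Relations of `r` missing from `s` start at minimal elements. These take the value `0` and all
  -- others a positive value, so the missing relations hold automatically.
  have heq0 : ∀ d, d 0 = {x | IsMinimal r x}.ncard → strictMaps s d = strictMaps r d := by
    intro d hd
    refine Set.Subset.antisymm ?_ (hsub d)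
    rintro f ⟨hf, rfl⟩
    refine ⟨fun x y hxy => ?_, rfl⟩
    have hz : ∀ x, f x = 0 ↔ IsMinimal r x := by
      intro x
      rw [← hminiff]
      refine zero_fiber_eq hf ?_ x
      rw [hd]
      simp only [hminiff]
    by_cases hx : IsMinimal r x
    · have hy : f y ≠ 0 := fun hy => (hz y).1 hy x hxy
      have := (hz x).2 hx
      omega
    · exact hf _ _ ⟨hxy, hκ4 x y hx hxy⟩
  -- Both counts are unchanged when the entry at `k` is moved to `0`, where they agree; the
  -- inclusion of finite sets is then an equality.
  have heq : ∀ d k, d k = {x | IsMinimal r x}.ncard → strictMaps s d = strictMaps r d := by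
    intro d k hd
    obtain ⟨d', h0, h1, h2⟩ := exists_weight_zero_eq h hs k d
    refine (Set.eq_of_subset_of_ncard_le (hsub d) ?_ (finite_strictMaps s d)).symm
    rw [h1, h2, heq0 d' (h0.trans hd)]
  have hclass : ∀ x y, r x y → κ x = κ y := by
    intro x y hxy
    by_contra hne
    -- The map `f` has a fibre of size `m`, so it is also `r`-strict, against `f x = f y`.
    obtain ⟨f, k, hf, hfxy, hw⟩ := exists_strict_eq_of_class_ne (s := s)
      (M := {x | IsMinimal r x}) (κ := κ) (fun x hx => hirr x hx.1)
      (fun x y z hxy hyz => ⟨htr _ _ _ hxy.1 hyz.1, hxy.2.trans hyz.2⟩) (fun x y h => h.2)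
      hschain hκM hκ1 hne
    have hmem : f ∈ strictMaps s (weight f) := ⟨hf, rfl⟩
    rw [heq _ k hw] at hmem
    have := hmem.1 x y hxy
    omega
  have hcmp : ∀ x y, Comparable r x y → κ x = κ y := by
    rintro x y (h | h | h)
    · exact hclass x y h
    · rw [h]
    · exact (hclass y x h).symm
  exact hκ3 _ _ ((hcmp _ _ hxy₀).trans (hcmp _ _ hyz₀))

end StrictMaps

namespace SchurLike

open StrictMaps

/-! ### Tableaux as strict maps on the poset of cells -/

/-- The relations between cells along which tableaux strictly increase. -/
def CellLt (D : Finset (ℕ × ℕ)) (c c' : {c : ℕ × ℕ // c ∈ D}) : Prop :=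
  (c.1.2 = c'.1.2 ∧ c.1.1 < c'.1.1) ∨ (c.1.1 = c'.1.1 ∧ c.1.2 < c'.1.2)

/-- The strict order on the cells generated by rows and columns. -/
def CellOrder (D : Finset (ℕ × ℕ)) : {c : ℕ × ℕ // c ∈ D} → {c : ℕ × ℕ // c ∈ D} → Prop :=
  Relation.TransGen (CellLt D)

/-- Every generating step raises row plus column, so the closure has no cycles. -/
theorem CellOrder.sum_lt {D : Finset (ℕ × ℕ)} {c c' : {c : ℕ × ℕ // c ∈ D}}
    (h : CellOrder D c c') : c.1.1 + c.1.2 < c'.1.1 + c'.1.2 := by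
  induction h with
  | single h => rcases h with h | h <;> omega
  | tail _ h ih => rcases h with h | h <;> omega

theorem CellOrder.irrefl {D : Finset (ℕ × ℕ)} (c : {c : ℕ × ℕ // c ∈ D}) :
    ¬ CellOrder D c c := fun h => lt_irrefl _ h.sum_lt

theorem CellOrder.trans {D : Finset (ℕ × ℕ)} (x y z : {c : ℕ × ℕ // c ∈ D})
    (h : CellOrder D x y) (h' : CellOrder D y z) : CellOrder D x z :=
  Relation.TransGen.trans h h'

theorem strict_iff {D : Finset (ℕ × ℕ)} (T : Filling D) :
    ColsStrict T ∧ RowsStrict T ↔ ∀ c c', CellOrder D c c' → T c < T c' := by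
  constructor
  · rintro ⟨h1, h2⟩ c c' h
    induction h with
    | single h =>
      rcases h with h | h
      · exact h1 _ _ h.1 h.2
      · exact h2 _ _ h.1 h.2
    | tail _ h ih =>
      rcases h with h | h
      · exact ih.trans (h1 _ _ h.1 h.2)
      · exact ih.trans (h2 _ _ h.1 h.2)
  · exact fun h => ⟨fun c c' h1 h2 => h _ _ (.single (.inl ⟨h1, h2⟩)),
      fun c c' h1 h2 => h _ _ (.single (.inr ⟨h1, h2⟩))⟩

theorem content_succPNat_apply {D : Finset (ℕ × ℕ)} (f : {c : ℕ × ℕ // c ∈ D} → ℕ) (k : ℕ) :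
    content (fun c => (f c).succPNat) k.succPNat = weight f k := by
  classical
  unfold content weight
  rw [Finsupp.finsetSum_apply]
  have h : {x | f x = k} = ↑(Finset.univ.filter (fun x => f x = k)) := by ext; simp
  rw [h, Set.ncard_coe_finset, Finset.card_filter]
  refine Finset.sum_congr rfl (fun c _ => ?_)
  rw [Finsupp.single_apply]
  simp only [Nat.succPNat_inj]

/-- The shift `k ↦ k + 1` from `ℕ` to `ℕ+` turns strict maps into tableaux and weights into
contents. -/
theorem ncard_strictMaps_cellOrder {D : Finset (ℕ × ℕ)} {d : ℕ → ℕ} {E : ℕ+ →₀ ℕ}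
    (hE : ∀ k, E (Nat.succPNat k) = d k) :
    (strictMaps (CellOrder D) d).ncard =
      {T : Filling D | T ∈ {T : Filling D | ColsStrict T ∧ RowsStrict T} ∧ content T = E}.ncard := by
  have hw : ∀ f : {c : ℕ × ℕ // c ∈ D} → ℕ,
      content (fun c => (f c).succPNat) = E ↔ weight f = d := by
    intro f
    constructor
    · intro h
      funext k
      rw [← content_succPNat_apply, h, hE]
    · intro h
      ext p
      rw [← PNat.succPNat_natPred p, content_succPNat_apply, h, hE]
  have hinj : Function.Injective
      (fun (f : {c : ℕ × ℕ // c ∈ D} → ℕ) => (fun c => (f c).succPNat : Filling D)) := by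
    intro f g hfg
    funext c
    exact Nat.succPNat_injective (congrFun hfg c)
  rw [← Set.ncard_image_of_injective _ hinj]
  congr 1
  ext T
  constructor
  · rintro ⟨f, ⟨hf, hfw⟩, rfl⟩
    exact ⟨(strict_iff _).2 (fun c c' h => Nat.succPNat_lt_succPNat.2 (hf c c' h)), (hw f).2 hfw⟩
  · rintro ⟨hT, hTE⟩
    have hT' : (fun c => ((T c).natPred).succPNat) = T := by
      funext c
      exact PNat.succPNat_natPred _
    refine ⟨fun c => (T c).natPred, ⟨fun c c' h => ?_, ?_⟩, hT'⟩
    · exact PNat.natPred_lt_natPred.2 ((strict_iff T).1 hT c c' h)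
    · exact (hw _).1 (by rw [hT', hTE])

/-! ### From symmetry to swap invariance -/

theorem monomialSymm_equivMapDomain {n : ℕ} (ν : Composition n) (σ : Equiv.Perm ℕ+)
    (d : ℕ+ →₀ ℕ) : monomialSymm ν (d.equivMapDomain σ) = monomialSymm ν d := by
  have key : ∀ (σ : Equiv.Perm ℕ+) (d : ℕ+ →₀ ℕ),
      (∃ i : Fin ν.length ↪ ℕ+, d = ∑ j, Finsupp.single (i j) (ν.blocksFun j)) →
      ∃ i : Fin ν.length ↪ ℕ+, d.equivMapDomain σ =
        ∑ j, Finsupp.single (i j) (ν.blocksFun j) := by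
    rintro σ d ⟨i, rfl⟩
    refine ⟨i.trans σ.toEmbedding, ?_⟩
    rw [Finsupp.equivMapDomain_eq_mapDomain, Finsupp.mapDomain_finsetSum]
    simp [Finsupp.mapDomain_single]
  unfold monomialSymm
  congr 1
  refine propext ⟨fun h => ?_, key σ d⟩
  have h1 := key σ.symm _ h
  rwa [← Finsupp.equivMapDomain_trans, Equiv.self_trans_symm, Finsupp.equivMapDomain_refl] at h1

theorem apply_equivMapDomain_of_mem_symFun {F : MvPowerSeries ℕ+ ℚ} (hF : F ∈ SymFun)
    (σ : Equiv.Perm ℕ+) (d : ℕ+ →₀ ℕ) : F (d.equivMapDomain σ) = F d := by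
  unfold SymFun at hF
  induction hF using Submodule.span_induction with
  | mem f hf =>
    obtain ⟨n, ν, -, rfl⟩ := hf
    exact monomialSymm_equivMapDomain ν σ d
  | zero => rfl
  | add f g _ _ hf hg =>
    change f _ + g _ = f _ + g _
    rw [hf, hg]
  | smul q f _ hf =>
    change q * f _ = q * f _
    rw [hf]

theorem swapInvariant_cellOrder {D : Finset (ℕ × ℕ)}
    (h : genFun {T : Filling D | ColsStrict T ∧ RowsStrict T} ∈ SymFun) :
    SwapInvariant (CellOrder D) := by
  intro d i
  -- Only a weight that is attained is known to come from a finitely supported exponent `E`; for the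
  -- others the inequality is trivial.
  rcases (strictMaps (CellOrder D) d).eq_empty_or_nonempty with h0 | ⟨f, -, hf⟩
  · simp [h0]
  set E := content (D := D) (fun c => (f c).succPNat) with hEdef
  have hE : ∀ k, E (Nat.succPNat k) = d k := fun k => by
    rw [hEdef, content_succPNat_apply, hf]
  let σ : Equiv.Perm ℕ+ := Equiv.swap i.succPNat (i + 1).succPNat
  have hE' : ∀ k, E.equivMapDomain σ (Nat.succPNat k) = (d ∘ Equiv.swap i (i + 1)) k := by
    intro k
    rw [Finsupp.equivMapDomain_apply, Function.comp, ← hE]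
    congr 1
    simp only [σ, Equiv.symm_swap, Equiv.swap_apply_def, Nat.succPNat_inj]
    split_ifs <;> rfl
  rw [ncard_strictMaps_cellOrder hE, ncard_strictMaps_cellOrder hE']
  have h1 := apply_equivMapDomain_of_mem_symFun h σ E
  unfold genFun at h1
  exact (Nat.cast_injective h1).ge

/-! ### Size of a diagram, connectedness, and the single column -/

theorem sum_range_getD (L : List ℕ) : ∀ N, L.length ≤ N →
    ∑ i ∈ Finset.range N, L.getD i 0 = L.sum := by
  induction L with
  | nil => simp
  | cons x L ih =>
    intro N hN
    obtain ⟨N, rfl⟩ : ∃ M, N = M + 1 := ⟨N - 1, by simp at hN; omega⟩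
    rw [Finset.sum_range_succ']
    simp only [List.getD_cons_succ, List.getD_cons_zero, List.sum_cons]
    rw [ih N (by simpa using hN), add_comm]

theorem sum_part {n : ℕ} (α : Composition n) {N : ℕ} (h : α.length ≤ N) :
    ∑ i ∈ Finset.range N, part α i = n := by
  unfold part
  rw [sum_range_getD _ _ h, α.blocks_sum]

theorem card_diagram {a l : ℕ} {α : Composition a} {lam : Composition l}
    (h : Contained lam α) : (diagram α lam).card = a - l := by
  unfold diagram
  rw [Finset.card_biUnion]
  · have h1 : ∀ i, ((Finset.Ico (part lam i) (part α i)).image (fun j => (i, j))).card =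
        part α i - part lam i := fun i => by
      rw [Finset.card_image_of_injective _ (fun x y hxy => (Prod.ext_iff.1 hxy).2), Nat.card_Ico]
    simp only [h1]
    -- Truncated subtraction commutes with the sum because each part of `lam` is at most that of
    -- `α`, the default `0` covering the rows beyond `lam`.
    rw [Finset.sum_tsub_distrib, sum_part α le_rfl, sum_part lam h.1]
    intro i _
    by_cases hi : i < lam.length
    · exact h.2 i hi
    · have : part lam i = 0 := List.getD_eq_default _ _ (by simpa using hi)
      omega
  · intro i _ j _ hij
    rw [Function.onFun, Finset.disjoint_left]
    intro c hc hc'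
    simp only [Finset.mem_image] at hc hc'
    obtain ⟨_, _, rfl⟩ := hc
    obtain ⟨_, _, h⟩ := hc'
    exact hij (Prod.ext_iff.1 h).1.symm

theorem mem_diagram_ones {n : ℕ} (i j : ℕ) :
    (i, j) ∈ diagram (Composition.ones n) emptyComp ↔ i < n ∧ j = 0 := by
  rw [mem_diagram, Composition.ones_length]
  have h0 : part emptyComp i = 0 := by simp [part, emptyComp]
  rw [h0]
  refine and_congr_right (fun hi => ?_)
  have h1 : part (Composition.ones n) i = 1 := by
    simp [part, Composition.ones, List.getD_eq_getElem?_getD, hi]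
  rw [h1]
  omega

/-- In a connected diagram, comparability can only be transitive if any two cells are
comparable. -/
theorem comparable_of_connected {a l : ℕ} {α : Composition a} {lam : Composition l}
    (hconn : DiagramConnected α lam)
    (htr : ∀ x y z, Comparable (CellOrder (diagram α lam)) x y →
      Comparable (CellOrder (diagram α lam)) y z → Comparable (CellOrder (diagram α lam)) x z)
    (c₀ c₁ : {c : ℕ × ℕ // c ∈ diagram α lam}) :
    Comparable (CellOrder (diagram α lam)) c₀ c₁ := by
  classical
  have hrow : ∀ c c' : {c : ℕ × ℕ // c ∈ diagram α lam}, c.1.1 = c'.1.1 →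
      Comparable (CellOrder (diagram α lam)) c c' := by
    intro c c' h
    rcases lt_trichotomy c.1.2 c'.1.2 with h1 | h1 | h1
    · exact Or.inl (.single (.inr ⟨h, h1⟩))
    · exact Or.inr (Or.inl (Subtype.ext (Prod.ext h h1)))
    · exact Or.inr (Or.inr (.single (.inr ⟨h.symm, h1⟩)))
  have hcol : ∀ c c' : {c : ℕ × ℕ // c ∈ diagram α lam}, c.1.2 = c'.1.2 →
      Comparable (CellOrder (diagram α lam)) c c' := by
    intro c c' h
    rcases lt_trichotomy c.1.1 c'.1.1 with h1 | h1 | h1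
    · exact Or.inl (.single (.inl ⟨h, h1⟩))
    · exact Or.inr (Or.inl (Subtype.ext (Prod.ext h1 h)))
    · exact Or.inr (Or.inr (.single (.inl ⟨h.symm, h1⟩)))
  by_contra hne
  -- If `c₀` and `c₁` were incomparable, the rows wholly comparable to `c₀` and the other rows would
  -- disconnect the diagram.
  let p : ℕ → Prop := fun i => ∀ c : {c : ℕ × ℕ // c ∈ diagram α lam}, c.1.1 = i →
    Comparable (CellOrder (diagram α lam)) c₀ c
  refine hconn ⟨(Finset.range α.length).filter p, (Finset.range α.length).filter (fun i => ¬ p i),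
    ⟨c₀.1.1, ?_⟩, ⟨c₁.1.1, ?_⟩, Finset.disjoint_filter_filter_not _ _ _,
    Finset.filter_union_filter_not_eq _ _, ?_⟩
  · rw [Finset.mem_filter, Finset.mem_range]
    exact ⟨((mem_diagram α lam _ _).1 c₀.2).1, fun c hc => hrow _ _ hc.symm⟩
  · rw [Finset.mem_filter, Finset.mem_range]
    exact ⟨((mem_diagram α lam _ _).1 c₁.2).1, fun h => hne (h c₁ rfl)⟩
  · rw [Finset.disjoint_left]
    intro j hj hj'
    simp only [columnsOf, Finset.mem_image, Finset.mem_filter] at hj hj'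
    obtain ⟨c, ⟨hc, -, hpc⟩, hcj⟩ := hj
    obtain ⟨c', ⟨hc', -, hpc'⟩, hcj'⟩ := hj'
    -- A shared column links `c₀` to `c`, then `c'`, then every cell `e` in the row of `c'`.
    refine hpc' (fun e he => ?_)
    refine htr _ ⟨c', hc'⟩ _ (htr _ ⟨c, hc⟩ _ (hpc _ rfl) (hcol _ _ ?_)) (hrow _ _ he.symm)
    rw [hcj, hcj']

/-- If the cells form a chain, the generating function of the strict tableaux is that of a
single column. -/
theorem genFun_eq_schur_ones {D : Finset (ℕ × ℕ)}
    (htot : ∀ c c', Comparable (CellOrder D) c c') :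
    genFun {T : Filling D | ColsStrict T ∧ RowsStrict T} = schur (Composition.ones D.card) := by
  set D' := diagram (Composition.ones D.card) emptyComp with hD'
  have hcard : Nat.card {c : ℕ × ℕ // c ∈ D} = D.card := by simp
  have hlt : ∀ c c', CellOrder D c c' ↔ height (CellOrder D) c < height (CellOrder D) c' := by
    intro c c'
    refine ⟨height_lt_height CellOrder.irrefl CellOrder.trans, fun h => ?_⟩
    rcases htot c c' with h' | h' | h'
    · exact h'
    · rw [h'] at h; omega
    · have := height_lt_height CellOrder.irrefl CellOrder.trans h'; omega
  -- In a chain the height is the rank, which serves as the row index in the column.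
  let e₀ : {c : ℕ × ℕ // c ∈ D} → {c : ℕ × ℕ // c ∈ D'} := fun c =>
    ⟨(height (CellOrder D) c, 0), (mem_diagram_ones _ _).2
      ⟨hcard ▸ height_lt_card CellOrder.irrefl c, rfl⟩⟩
  have hinj : Function.Injective e₀ := by
    intro c c' h
    have h1 : height (CellOrder D) c = height (CellOrder D) c' :=
      congrArg (fun c => c.1.1) h
    rcases htot c c' with h' | h' | h'
    · rw [hlt] at h'; omega
    · exact h'
    · rw [hlt] at h'; omega
  have hsurj : Function.Surjective e₀ := by
    have hc : D'.card = D.card := by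
      rw [hD', card_diagram ⟨by simp [emptyComp, Composition.length], by
        simp [emptyComp, Composition.length]⟩]
      rfl
    exact ((Fintype.bijective_iff_injective_and_card e₀).2 ⟨hinj, by simp [hc]⟩).2
  let e := Equiv.ofBijective e₀ ⟨hinj, hsurj⟩
  have hstrict : ∀ T : Filling D', ColsStrict T ∧ RowsWeak T ↔
      ColsStrict (fun c => T (e c)) ∧ RowsStrict (fun c => T (e c)) := by
    intro T
    rw [strict_iff]
    have hzero : ∀ c : {c : ℕ × ℕ // c ∈ D'}, c.1.2 = 0 :=
      fun c => ((mem_diagram_ones _ _).1 c.2).2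
    constructor
    · intro h c c' hcc
      exact h.1 _ _ rfl ((hlt _ _).1 hcc)
    · refine fun h => ⟨fun c c' _ hcc => ?_, fun c c' _ hcc => ?_⟩
      · obtain ⟨c, rfl⟩ := e.surjective c
        obtain ⟨c', rfl⟩ := e.surjective c'
        exact h _ _ ((hlt _ _).2 hcc)
      -- All cells lie in column `0`, so the weak row condition is vacuous.
      · rw [hzero, hzero] at hcc
        omega
  funext E
  unfold schur skewSchur genFun
  congr 1
  have hinj' : Function.Injective (fun (T : Filling D') => (fun c => T (e c) : Filling D)) :=
    fun T T' h => e.surjective.injective_comp_right h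
  have hcont : ∀ T : Filling D', content (fun c => T (e c) : Filling D) = content T :=
    fun T => Equiv.sum_comp e (fun c => Finsupp.single (T c) 1)
  rw [← Set.ncard_image_of_injective _ hinj']
  congr 1
  ext T
  constructor
  · rintro ⟨hT, hTE⟩
    have hT' : (fun c => (fun c' => T (e.symm c') : Filling D') (e c)) = T := by
      funext c; simp
    refine ⟨fun c => T (e.symm c), ⟨(hstrict _).2 ?_, ?_⟩, hT'⟩
    · rwa [hT']
    · rw [← hcont, hT', hTE]
  · rintro ⟨T, ⟨hT, hTE⟩, rfl⟩
    exact ⟨(hstrict T).1 hT, (hcont T).trans hTE⟩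

end SchurLike

theorem corollary5p7 {a l : ℕ} (α : Composition a) (lam : Composition l)
    (hlam : SchurLike.IsPartition lam) (hsub : SchurLike.Contained lam α)
    (hrows : SchurLike.RowsNonempty α lam) (hconn : SchurLike.DiagramConnected α lam)
    (hsym : SchurLike.strictlyAdvancedExtended α lam ∈ SchurLike.SymFun) :
    SchurLike.strictlyAdvancedExtended α lam = SchurLike.schur (Composition.ones (a - l)) := by
  rw [← SchurLike.card_diagram hsub]
  exact SchurLike.genFun_eq_schur_ones (SchurLike.comparable_of_connected hconn
    (StrictMaps.SwapInvariant.comparable_trans _ rfl (SchurLike.swapInvariant_cellOrder hsym)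
      SchurLike.CellOrder.irrefl SchurLike.CellOrder.trans))
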